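/- **Setting.** Let $n,t,f\in\mathbb N$ with $f\le t$ and $3t<n$. There are $n$ processes $p_1,\dots,p_n$, of which exactly $f$ are Byzantine (they may send arbitrary messages to any process at any time); the others are correct. Processes communicate over an asynchronous, reliable, fully connected point-to-point network: the receiver knows the sender of a message, there is no bound on delays, but every message sent by a correct process to a correct process is eventually received. An execution is an infinite sequence of atomic steps, interleaved arbitrarily, such that no step of the algorithm below remains possible for a correct process forever without being taken. **Algorithm.** Each correct process $p_i$ proposes a binary value, the initial value of its estimate $\mathit{est}_i\in\{0,1\}$, and executes rounds $r=r_0,r_0+1,r_0+2,\dots$, where the number $r_0\in\mathbb N$ of the first round is arbitrary but common to all processes. All messages and variables (other than the estimate and the decision) are tagged with the round number. In round $r$: 1. $p_i$ invokes $\mathit{bv\text{-}broadcast}(\mathit{est}_i)$: it broadcasts $(\mathrm{BV},\mathit{est}_i)$ to all processes (itself included); from then on, and forever, it broadcasts $(\mathrm{BV},v)$ if it has received $(\mathrm{BV},v)$ of round $r$ from $t+1$ distinct processes and has not yet broadcast it in this round, and it adds $v$ to its set $\mathit{contestants}_i$ of round $r$ ("$p_i$ bv-delivers $v$") once it has received $(\mathrm{BV},v)$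 of round $r$ from $2t+1$ distinct processes. 2. $p_i$ waits until $\mathit{contestants}_i\neq\emptyset$ and then broadcasts $(\mathrm{AUX},\mathit{contestants}_i)$ to all processes; let $\mathit{favorites}_i[j]$ be the union of the sets received in $\mathrm{AUX}$ messages of round $r$ from $p_j$. 3. $p_i$ waits until there are $n-t$ distinct processes $p_{c_1},\dots,p_{c_{n-t}}$ such that $\mathit{favorites}_i[c_j]\ne\emptyset$ for all $j$ and $\mathit{qualifiers}_i:=\bigcup_j \mathit{favorites}_i[c_j]\subseteq \mathit{contestants}_i$. 4. If $\mathit{qualifiers}_i=\{v\}$, then $p_i$ sets $\mathit{est}_i:=v$ and, if moreover $v=r\bmod 2$, decides $v$ (only its first decision counts); otherwise it sets $\mathit{est}_i:=r\bmod 2$. Then it starts round $r+1$. **Fairness.** The bv-broadcast execution of round $r$ is *$v$-good* if all correct processes bv-deliver $v$ first, that is, if at no time a correct process has bv-delivered $1-v$ and not $v$ in round $r$. The sequence of bv-broadcast executions is *fair* if there is a round $r\ge r_0$ whose bv-broadcast execution is $(r\bmod 2)$-good. **Theorem.** In every execution of this algorithm whose sequence of bv-broadcast executions is fair, every correct process eventually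 decides. -/

import Mathlib

/-! The DBFT binary Byzantine consensus algorithm (without coordinator and timeouts), with its
embedded binary value broadcast, in the asynchronous message-passing model with Byzantine
processes. Processes are the elements of `Fin n`, binary values the elements of `Fin 2`. -/

namespace DBFT

/-- The binary value `r mod 2`. -/
def roundParity (r : ℕ) : Fin 2 := ⟨r % 2, Nat.mod_lt r two_pos⟩

/-- Messages, tagged with the number of the round they belong to. The sender of a message is
known to its receiver (point-to-point channels) and is recorded separately. -/
inductive Message where
  /-- `(BV, v)`, sent in the bv-broadcast of round `r`. -/
  | bv (r : ℕ) (v : Fin 2)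
  /-- `(AUX, S)`, carrying a set `S` of binary values, sent in round `r`. -/
  | aux (r : ℕ) (S : Set (Fin 2))

/-- Where a correct process stands in the current iteration of its main loop. -/
inductive Phase where
  /-- about to invoke bv-broadcast with its current estimate -/
  | start
  /-- waiting until `contestants` is non-empty, in order to broadcast its AUX message -/
  | waitContestants
  /-- waiting for suitable AUX messages from `n - t` distinct processes -/
  | waitFavorites

/-- The local state of a correct process. The variables of the bv-broadcast are indexed by the
round number, since the instance of a round, once invoked, keeps running for ever. -/
structure LocalState (n : ℕ) where
  /-- current round number -/
  round : ℕ
  /-- current estimate -/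
  est : Fin 2
  /-- position in the loop -/
  phase : Phase
  /-- values already broadcast in a BV message by the bv-broadcast instance of each round -/
  bvSent : ℕ → Set (Fin 2)
  /-- values bv-delivered by the bv-broadcast instance of each round -/
  contestants : ℕ → Set (Fin 2)
  /-- all pairs (sender, message) received so far -/
  received : Set (Fin n × Message)
  /-- the first value decided, if any -/
  decision : Option (Fin 2)

namespace LocalState

variable {n : ℕ}

/-- The number of distinct processes from which `(BV, v)` of round `r` has been received. -/
noncomputable def bvCount (s : LocalState n) (r : ℕ) (v : Fin 2) : ℕ :=
  Set.ncard {j : Fin n | (j, Message.bv r v) ∈ s.received}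

/-- `favorites[j]` of round `r`: the union of the sets received from `j` in AUX messages. -/
def favorites (s : LocalState n) (r : ℕ) (j : Fin n) : Set (Fin 2) :=
  {v | ∃ S : Set (Fin 2), (j, Message.aux r S) ∈ s.received ∧ v ∈ S}

/-- `Q` consists of `n - t` distinct processes with non-empty `favorites` in the current round,
and the union of these `favorites` is the set `qualifiers`, which is included in the current
`contestants`. -/
def IsQuorum (t : ℕ) (s : LocalState n) (Q : Finset (Fin n)) (qualifiers : Set (Fin 2)) : Prop :=
  Q.card = n - t ∧
  (∀ j ∈ Q, (s.favorites s.round j).Nonempty) ∧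
  qualifiers = (⋃ j ∈ Q, s.favorites s.round j) ∧
  qualifiers ⊆ s.contestants s.round

open Classical in
/-- The end of an iteration: if `qualifiers` is a singleton `{v}`, the estimate becomes `v`, and
`v` is decided if it is the parity of the round; otherwise the estimate becomes the parity of the
round. Only the first decision is recorded. Then the next round starts. -/
noncomputable def endRound (s : LocalState n) (qualifiers : Set (Fin 2)) : LocalState n :=
  { s with
    est := if qualifiers = {0} then 0 else if qualifiers = {1} then 1 else roundParity s.round
    decision := if qualifiers = {roundParity s.round} then
        (s.decision <|> some (roundParity s.round)) else s.decision
    round := s.round + 1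
    phase := Phase.start }

/-- The initial state of a process that proposes `v`, with first round number `r₀`. -/
def initial (r₀ : ℕ) (v : Fin 2) : LocalState n where
  round := r₀
  est := v
  phase := Phase.start
  bvSent := fun _ => ∅
  contestants := fun _ => ∅
  received := ∅
  decision := none

end LocalState

/-- A global configuration: the local states (only those of correct processes matter) and the set
of all triples (sender, receiver, message) sent so far. -/
structure Config (n : ℕ) where
  state : Fin n → LocalState n
  sent : Set (Fin n × Fin n × Message)

namespace Config

variable {n : ℕ}

/-- Replace the local state of process `i` by `s`. -/
def setState (c : Config n) (i : Fin n) (s : LocalState n) : Config n :=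
  { c with state := Function.update c.state i s }

/-- Process `i` sends `m` to every process, itself included. -/
def broadcast (c : Config n) (i : Fin n) (m : Message) : Config n :=
  { c with sent := c.sent ∪ {x | ∃ j : Fin n, x = (i, j, m)} }

end Config

/-- The atomic steps. -/
inductive Action (n : ℕ) where
  /-- `i` invokes bv-broadcast with its estimate, in its current round -/
  | bvBroadcast (i : Fin n)
  /-- the bv-broadcast instance of round `r` at `i` broadcasts `v` after `t + 1` receptions -/
  | bvRebroadcast (i : Fin n) (r : ℕ) (v : Fin 2)
  /-- the bv-broadcast instance of round `r` at `i` delivers `v` after `2t + 1` receptions -/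
  | bvDeliver (i : Fin n) (r : ℕ) (v : Fin 2)
  /-- `i` broadcasts its AUX message of its current round -/
  | auxBroadcast (i : Fin n)
  /-- `i` finishes its current round -/
  | finishRound (i : Fin n)
  /-- `i` receives the message `m` from `j` -/
  | receive (i j : Fin n) (m : Message)
  /-- the Byzantine process `j` sends an arbitrary message `m` to `i` -/
  | byzantineSend (j i : Fin n) (m : Message)
  /-- nothing happens -/
  | idle

/-- The steps of the algorithm proper, which a correct process may not postpone for ever. -/
def Action.IsAlgorithmStep {n : ℕ} : Action n → Prop
  | .bvBroadcast _ => True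
  | .bvRebroadcast _ _ _ => True
  | .bvDeliver _ _ _ => True
  | .auxBroadcast _ => True
  | .finishRound _ => True
  | .receive _ _ _ => False
  | .byzantineSend _ _ _ => False
  | .idle => False

/-- `Step t byz c a d`: the step `a` is possible in configuration `c` and may lead to `d`, where
`t` is the resilience parameter and `byz` is the set of Byzantine processes. The bv-broadcast
instance of round `r` at `i` has been invoked exactly when its set `bvSent r` is non-empty. -/
def Step {n : ℕ} (t : ℕ) (byz : Finset (Fin n)) (c : Config n) : Action n → Config n → Prop
  | .bvBroadcast i, d =>
      let s := c.state i
      i ∉ byz ∧ s.phase = Phase.start ∧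
      d = (c.broadcast i (Message.bv s.round s.est)).setState i
        { s with
          phase := Phase.waitContestants
          bvSent := Function.update s.bvSent s.round (s.bvSent s.round ∪ {s.est}) }
  | .bvRebroadcast i r v, d =>
      let s := c.state i
      i ∉ byz ∧ (s.bvSent r).Nonempty ∧ v ∉ s.bvSent r ∧ t + 1 ≤ s.bvCount r v ∧
      d = (c.broadcast i (Message.bv r v)).setState i
        { s with bvSent := Function.update s.bvSent r (s.bvSent r ∪ {v}) }
  | .bvDeliver i r v, d =>
      let s := c.state i
      i ∉ byz ∧ (s.bvSent r).Nonempty ∧ v ∉ s.contestants r ∧ 2 * t + 1 ≤ s.bvCount r v ∧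
      d = c.setState i
        { s with contestants := Function.update s.contestants r (s.contestants r ∪ {v}) }
  | .auxBroadcast i, d =>
      let s := c.state i
      i ∉ byz ∧ s.phase = Phase.waitContestants ∧ (s.contestants s.round).Nonempty ∧
      d = (c.broadcast i (Message.aux s.round (s.contestants s.round))).setState i
        { s with phase := Phase.waitFavorites }
  | .finishRound i, d =>
      let s := c.state i
      i ∉ byz ∧ s.phase = Phase.waitFavorites ∧
      ∃ (Q : Finset (Fin n)) (qualifiers : Set (Fin 2)),
        s.IsQuorum t Q qualifiers ∧ d = c.setState i (s.endRound qualifiers)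
  | .receive i j m, d =>
      let s := c.state i
      i ∉ byz ∧ (j, i, m) ∈ c.sent ∧
      d = c.setState i { s with received := s.received ∪ {(j, m)} }
  | .byzantineSend j i m, d =>
      j ∈ byz ∧ d = { c with sent := c.sent ∪ {(j, i, m)} }
  | .idle, d => d = c

/-- The step `a` is possible in configuration `c`. -/
def Enabled {n : ℕ} (t : ℕ) (byz : Finset (Fin n)) (c : Config n) (a : Action n) : Prop :=
  ∃ d, Step t byz c a d

/-- An infinite asynchronous execution `σ 0, act 0, σ 1, act 1, …` over a reliable network. -/
structure IsExecution {n : ℕ} (t : ℕ) (byz : Finset (Fin n)) (r₀ : ℕ) (proposal : Fin n → Fin 2)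
    (σ : ℕ → Config n) (act : ℕ → Action n) : Prop where
  /-- initially, each correct process proposes its value, -/
  init_state : ∀ i, i ∉ byz → (σ 0).state i = LocalState.initial r₀ (proposal i)
  /-- and no message has been sent; -/
  init_sent : (σ 0).sent = ∅
  /-- at each point in time one step is taken; -/
  step : ∀ k, Step t byz (σ k) (act k) (σ (k + 1))
  /-- every message sent by a correct process to a correct process is eventually received; -/
  reliable : ∀ i j m k, i ∉ byz → j ∉ byz → (j, i, m) ∈ (σ k).sent →
    ∃ l, (j, m) ∈ ((σ l).state i).received
  /-- no step of the algorithm remains possible for ever without being taken. -/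
  progress : ∀ a : Action n, a.IsAlgorithmStep →
    ∀ k, ∃ l, k ≤ l ∧ (act l = a ∨ ¬ Enabled t byz (σ l) a)

/-- The bv-broadcast execution of round `r` is `v`-good: the correct processes bv-deliver `v`
first, that is, at no time has a correct process bv-delivered `1 - v` and not `v`. -/
def GoodBV {n : ℕ} (byz : Finset (Fin n)) (σ : ℕ → Config n) (r : ℕ) (v : Fin 2) : Prop :=
  ∀ i, i ∉ byz → ∀ k, ((σ k).state i).contestants r ≠ {1 - v}

/-- Fairness of the infinite sequence of bv-broadcast executions, in rounds `r₀, r₀ + 1, …`. -/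
def FairBV {n : ℕ} (byz : Finset (Fin n)) (r₀ : ℕ) (σ : ℕ → Config n) : Prop :=
  ∃ r, r₀ ≤ r ∧ GoodBV byz σ r (roundParity r)

/-- Termination: every correct process eventually decides on a value. -/
def Terminates {n : ℕ} (byz : Finset (Fin n)) (σ : ℕ → Config n) : Prop :=
  ∀ i, i ∉ byz → ∃ (k : ℕ) (v : Fin 2), ((σ k).state i).decision = some v

end DBFT

namespace DBFT

open Filter

/-! ### Effect of a single step on the configuration -/

section Steps

variable {n t : ℕ} {byz : Finset (Fin n)} {c d : Config n} {a : Action n}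

/-! Let `r` be the round given by fairness and `v = roundParity r`. A quorum of round `r` has `n - t
> t` members, hence a correct one, whose AUX set is a non-empty snapshot of its contestants.
Goodness forbids the snapshot `{1 - v}`, so `v` is among the qualifiers. They are then `{v}` or both
values, and either way the new estimate is `v` (`endRound_est_of_good`).

From then on unanimity is self-sustaining. If all correct processes start a round with `v`, the
Byzantine ones are too few to get `1 - v` re-broadcast or delivered (`contestants_subset`), so all
qualifiers are `{v}`. Round `r + 1` thus preserves `v`, and in round `r + 2`, which has the parity
of `r`, every correct process that finishes has a decision.

It remains to see that no correct process is blocked (`exists_finishRound`, `exists_start`). By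
pigeonhole, `t + 1` of the more than `2t` correct processes broadcast the same value, so every
correct process delivers something (`bv_termination`). Whatever one of them delivers, all deliver
(`bv_uniformity`), so the AUX sets of correct processes eventually lie in everyone's contestants and
a quorum of correct processes is available. -/

theorem Step.sent_mono (h : Step t byz c a d) : c.sent ⊆ d.sent := by
  cases a <;> simp only [Step] at h
  case idle => rw [h]
  case finishRound => obtain ⟨-, -, Q, q, -, rfl⟩ := h; exact subset_rfl
  case byzantineSend => obtain ⟨-, rfl⟩ := h; exact Set.subset_union_left
  case bvBroadcast => obtain ⟨-, -, rfl⟩ := h; exact Set.subset_union_left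
  case bvRebroadcast => obtain ⟨-, -, -, -, rfl⟩ := h; exact Set.subset_union_left
  case bvDeliver => obtain ⟨-, -, -, -, rfl⟩ := h; exact subset_rfl
  case auxBroadcast => obtain ⟨-, -, -, rfl⟩ := h; exact Set.subset_union_left
  case receive => obtain ⟨-, -, rfl⟩ := h; exact subset_rfl

/-- The local variables that only grow do so in every step. -/
theorem Step.state_mono (h : Step t byz c a d) (i : Fin n) :
    (∀ r, (c.state i).bvSent r ⊆ (d.state i).bvSent r) ∧
    (∀ r, (c.state i).contestants r ⊆ (d.state i).contestants r) ∧
    (c.state i).received ⊆ (d.state i).received := by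
  cases a <;> simp only [Step] at h
  case idle => rw [h]; simp
  case finishRound j =>
    obtain ⟨-, -, Q, q, -, rfl⟩ := h
    by_cases hij : i = j <;> simp [Config.setState, LocalState.endRound, hij]
  case byzantineSend => obtain ⟨-, rfl⟩ := h; simp
  case bvBroadcast j =>
    obtain ⟨-, -, rfl⟩ := h
    by_cases hij : i = j
    · subst hij
      refine ⟨fun r => ?_, by simp [Config.setState]⟩
      by_cases hr : r = (c.state i).round
      · subst hr; simp [Config.setState]
      · simp [Config.setState, Function.update_of_ne hr]
    · simp [Config.setState, Config.broadcast, hij]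
  case bvRebroadcast j r v =>
    obtain ⟨-, -, -, -, rfl⟩ := h
    by_cases hij : i = j
    · subst hij
      refine ⟨fun r' => ?_, by simp [Config.setState]⟩
      by_cases hr : r' = r
      · subst hr; simp [Config.setState]
      · simp [Config.setState, Function.update_of_ne hr]
    · simp [Config.setState, Config.broadcast, hij]
  case bvDeliver j r v =>
    obtain ⟨-, -, -, -, rfl⟩ := h
    by_cases hij : i = j
    · subst hij
      refine ⟨by simp [Config.setState], fun r' => ?_, by simp [Config.setState]⟩
      by_cases hr : r' = r
      · subst hr; simp [Config.setState]
      · simp [Config.setState, Function.update_of_ne hr]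
    · simp [Config.setState, hij]
  case auxBroadcast j =>
    obtain ⟨-, -, -, rfl⟩ := h
    by_cases hij : i = j <;> simp [Config.setState, Config.broadcast, hij]
  case receive j _ _ =>
    obtain ⟨-, -, rfl⟩ := h
    by_cases hij : i = j <;> simp [Config.setState, hij]

/-- Only the process itself moves its program counter and its estimate, in its own main loop, and
the estimate only at the end of a round. -/
theorem Step.control_eq (h : Step t byz c a d) (i : Fin n) (h₁ : a ≠ .bvBroadcast i)
    (h₂ : a ≠ .auxBroadcast i) (h₃ : a ≠ .finishRound i) :
    (d.state i).round = (c.state i).round ∧ (d.state i).phase = (c.state i).phase ∧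
    (d.state i).est = (c.state i).est := by
  cases a <;> simp only [Step] at h
  case idle => rw [h]; simp
  case finishRound j =>
    obtain ⟨-, -, Q, q, -, rfl⟩ := h
    have hij : i ≠ j := fun e => h₃ (e ▸ rfl)
    simp [Config.setState, hij]
  case byzantineSend => obtain ⟨-, rfl⟩ := h; simp
  case bvBroadcast j =>
    obtain ⟨-, -, rfl⟩ := h
    have hij : i ≠ j := fun e => h₁ (e ▸ rfl)
    simp [Config.setState, Config.broadcast, hij]
  case bvRebroadcast j r v =>
    obtain ⟨-, -, -, -, rfl⟩ := h
    by_cases hij : i = j <;> simp [Config.setState, Config.broadcast, hij]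
  case bvDeliver j r v =>
    obtain ⟨-, -, -, -, rfl⟩ := h
    by_cases hij : i = j <;> simp [Config.setState, hij]
  case auxBroadcast j =>
    obtain ⟨-, -, -, rfl⟩ := h
    have hij : i ≠ j := fun e => h₂ (e ▸ rfl)
    simp [Config.setState, Config.broadcast, hij]
  case receive j _ _ =>
    obtain ⟨-, -, rfl⟩ := h
    by_cases hij : i = j <;> simp [Config.setState, hij]

theorem Step.received_new (h : Step t byz c a d) {i j : Fin n} {m : Message}
    (hm : (j, m) ∈ (d.state i).received) :
    (j, m) ∈ (c.state i).received ∨ (j, i, m) ∈ c.sent := by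
  cases a <;> simp only [Step] at h
  case idle => rw [h] at hm; exact .inl hm
  case finishRound k =>
    obtain ⟨-, -, Q, q, -, rfl⟩ := h
    by_cases hij : i = k <;> simp_all [Config.setState, LocalState.endRound]
  case byzantineSend => obtain ⟨-, rfl⟩ := h; exact .inl hm
  case bvBroadcast k =>
    obtain ⟨-, -, rfl⟩ := h
    by_cases hij : i = k <;> simp_all [Config.setState, Config.broadcast]
  case bvRebroadcast k r v =>
    obtain ⟨-, -, -, -, rfl⟩ := h
    by_cases hij : i = k <;> simp_all [Config.setState, Config.broadcast]
  case bvDeliver k r v =>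
    obtain ⟨-, -, -, -, rfl⟩ := h
    by_cases hij : i = k <;> simp_all [Config.setState]
  case auxBroadcast k =>
    obtain ⟨-, -, -, rfl⟩ := h
    by_cases hij : i = k <;> simp_all [Config.setState, Config.broadcast]
  case receive k _ _ =>
    obtain ⟨-, hs, rfl⟩ := h
    by_cases hij : i = k
    · subst hij
      simp only [Config.setState, Function.update_self, Set.union_singleton, Set.mem_insert_iff,
        Prod.mk.injEq] at hm
      rcases hm with ⟨rfl, rfl⟩ | hm
      exacts [.inr hs, .inl hm]
    · simp_all [Config.setState]

/-- A value that enters `bvSent` is the estimate of a process starting its round, or has been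
received from `t + 1` processes. -/
theorem Step.bvSent_new (h : Step t byz c a d) {i : Fin n} {r : ℕ} {v : Fin 2}
    (hv : v ∈ (d.state i).bvSent r) :
    v ∈ (c.state i).bvSent r ∨
    ((c.state i).phase = .start ∧ (c.state i).round = r ∧ (c.state i).est = v) ∨
    t + 1 ≤ (c.state i).bvCount r v := by
  cases a <;> simp only [Step] at h
  case idle => rw [h] at hv; exact .inl hv
  case finishRound k =>
    obtain ⟨-, -, Q, q, -, rfl⟩ := h
    by_cases hij : i = k <;> simp_all [Config.setState, LocalState.endRound]
  case byzantineSend => obtain ⟨-, rfl⟩ := h; exact .inl hv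
  case bvBroadcast k =>
    obtain ⟨-, hp, rfl⟩ := h
    by_cases hij : i = k
    · subst hij
      by_cases hr : r = (c.state i).round
      · subst hr
        simp only [Config.setState, Function.update_self, Set.union_singleton,
          Set.mem_insert_iff] at hv
        rcases hv with rfl | hv
        exacts [.inr (.inl ⟨hp, rfl, rfl⟩), .inl hv]
      · simp_all [Config.setState]
    · simp_all [Config.setState, Config.broadcast]
  case bvRebroadcast k r' v' =>
    obtain ⟨-, -, -, hc, rfl⟩ := h
    by_cases hij : i = k
    · subst hij
      by_cases hr : r = r'
      · subst hr
        simp only [Config.setState, Function.update_self, Set.union_singleton,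
          Set.mem_insert_iff] at hv
        rcases hv with rfl | hv
        exacts [.inr (.inr hc), .inl hv]
      · simp_all [Config.setState]
    · simp_all [Config.setState, Config.broadcast]
  case bvDeliver k r v =>
    obtain ⟨-, -, -, -, rfl⟩ := h
    by_cases hij : i = k <;> simp_all [Config.setState]
  case auxBroadcast k =>
    obtain ⟨-, -, -, rfl⟩ := h
    by_cases hij : i = k <;> simp_all [Config.setState, Config.broadcast]
  case receive k _ _ =>
    obtain ⟨-, hs, rfl⟩ := h
    by_cases hij : i = k <;> simp_all [Config.setState]

theorem Step.contestants_new (h : Step t byz c a d) {i : Fin n} {r : ℕ} {v : Fin 2}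
    (hv : v ∈ (d.state i).contestants r) :
    v ∈ (c.state i).contestants r ∨ 2 * t + 1 ≤ (c.state i).bvCount r v := by
  cases a <;> simp only [Step] at h
  case idle => rw [h] at hv; exact .inl hv
  case finishRound k =>
    obtain ⟨-, -, Q, q, -, rfl⟩ := h
    by_cases hij : i = k <;> simp_all [Config.setState, LocalState.endRound]
  case byzantineSend => obtain ⟨-, rfl⟩ := h; exact .inl hv
  case bvBroadcast k =>
    obtain ⟨-, hp, rfl⟩ := h
    by_cases hij : i = k <;> simp_all [Config.setState, Config.broadcast]
  case bvRebroadcast k r' v' =>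
    obtain ⟨-, -, -, hc, rfl⟩ := h
    by_cases hij : i = k <;> simp_all [Config.setState, Config.broadcast]
  case bvDeliver k r' v' =>
    obtain ⟨-, -, -, hc, rfl⟩ := h
    by_cases hij : i = k
    · subst hij
      by_cases hr : r = r'
      · subst hr
        simp only [Config.setState, Function.update_self, Set.union_singleton,
          Set.mem_insert_iff] at hv
        rcases hv with rfl | hv
        exacts [.inr hc, .inl hv]
      · simp_all [Config.setState]
    · simp_all [Config.setState]
  case auxBroadcast k =>
    obtain ⟨-, -, -, rfl⟩ := h
    by_cases hij : i = k <;> simp_all [Config.setState, Config.broadcast]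
  case receive k _ _ =>
    obtain ⟨-, hs, rfl⟩ := h
    by_cases hij : i = k <;> simp_all [Config.setState]

/-- Channels reveal the sender, so a Byzantine step cannot forge a message of the correct `j`;
non-emptiness is the guard of `auxBroadcast`. -/
theorem Step.sent_aux_new (h : Step t byz c a d) {i j : Fin n} (hj : j ∉ byz) {r : ℕ}
    {S : Set (Fin 2)} (hm : (j, i, Message.aux r S) ∈ d.sent) :
    (j, i, Message.aux r S) ∈ c.sent ∨ S = (c.state j).contestants r ∧ S.Nonempty := by
  cases a <;> simp only [Step] at h
  case idle => rw [h] at hm; exact .inl hm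
  case finishRound => obtain ⟨-, -, Q, q, -, rfl⟩ := h; exact .inl hm
  case byzantineSend =>
    obtain ⟨hb, rfl⟩ := h
    rcases hm with hm | hm
    · exact .inl hm
    · simp only [Set.mem_singleton_iff, Prod.mk.injEq] at hm
      exact absurd (hm.1 ▸ hb) hj
  case bvBroadcast =>
    obtain ⟨-, -, rfl⟩ := h
    simpa [Config.setState, Config.broadcast] using Or.inl hm
  case bvRebroadcast =>
    obtain ⟨-, -, -, -, rfl⟩ := h
    simpa [Config.setState, Config.broadcast] using Or.inl hm
  case bvDeliver => obtain ⟨-, -, -, -, rfl⟩ := h; exact .inl hm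
  case auxBroadcast k =>
    obtain ⟨-, -, hne, rfl⟩ := h
    rcases hm with hm | ⟨l, hm⟩
    · exact .inl hm
    · simp only [Prod.mk.injEq, Message.aux.injEq] at hm
      obtain ⟨rfl, -, rfl, rfl⟩ := hm
      exact .inr ⟨rfl, hne⟩
  case receive => obtain ⟨-, -, rfl⟩ := h; exact .inl hm

/-- The BV messages sent by a correct process are those recorded in its `bvSent`. -/
theorem Step.sent_bv_iff (h : Step t byz c a d) {i j : Fin n} (hj : j ∉ byz) {r : ℕ} {v : Fin 2}
    (hc : (j, i, Message.bv r v) ∈ c.sent ↔ v ∈ (c.state j).bvSent r) :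
    (j, i, Message.bv r v) ∈ d.sent ↔ v ∈ (d.state j).bvSent r := by
  cases a <;> simp only [Step] at h
  case idle => rwa [h]
  case finishRound k =>
    obtain ⟨-, -, Q, q, -, rfl⟩ := h
    by_cases hij : j = k
    · subst hij; simpa [Config.setState, LocalState.endRound] using hc
    · simpa [Config.setState, hij] using hc
  case byzantineSend k _ _ =>
    obtain ⟨hb, rfl⟩ := h
    have : j ≠ k := fun e => hj (e ▸ hb)
    simpa [this] using hc
  case bvBroadcast k =>
    obtain ⟨-, -, rfl⟩ := h
    by_cases hij : j = k
    · subst hij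
      by_cases hr : r = (c.state j).round
      · subst hr
        simp [Config.setState, Config.broadcast, hc, or_comm]
      · simp [Config.setState, Config.broadcast, hc, hr]
    · simp [Config.setState, Config.broadcast, hij, hc]
  case bvRebroadcast k r' v' =>
    obtain ⟨-, -, -, -, rfl⟩ := h
    by_cases hij : j = k
    · subst hij
      by_cases hr : r = r'
      · subst hr
        simp [Config.setState, Config.broadcast, hc, or_comm]
      · simp [Config.setState, Config.broadcast, hc, hr]
    · simp [Config.setState, Config.broadcast, hij, hc]
  case bvDeliver k _ _ =>
    obtain ⟨-, -, -, -, rfl⟩ := h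
    by_cases hij : j = k
    · subst hij; simpa [Config.setState] using hc
    · simpa [Config.setState, hij] using hc
  case auxBroadcast k =>
    obtain ⟨-, -, -, rfl⟩ := h
    by_cases hij : j = k
    · subst hij; simpa [Config.setState, Config.broadcast] using hc
    · simpa [Config.setState, Config.broadcast, hij] using hc
  case receive k _ _ =>
    obtain ⟨-, -, rfl⟩ := h
    by_cases hij : j = k
    · subst hij; simpa [Config.setState] using hc
    · simpa [Config.setState, hij] using hc

theorem Step.of_bvBroadcast {i : Fin n} (h : Step t byz c (.bvBroadcast i) d) :
    (d.state i).round = (c.state i).round ∧ (d.state i).phase = .waitContestants ∧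
    ((d.state i).bvSent (c.state i).round).Nonempty := by
  obtain ⟨-, -, rfl⟩ := h
  simp [Config.setState]

theorem Step.of_auxBroadcast {i : Fin n} (h : Step t byz c (.auxBroadcast i) d) :
    (d.state i).round = (c.state i).round ∧ (d.state i).phase = .waitFavorites ∧
    ∃ S : Set (Fin 2), S.Nonempty ∧ ∀ j, (i, j, Message.aux (c.state i).round S) ∈ d.sent := by
  obtain ⟨-, -, hne, rfl⟩ := h
  refine ⟨?_, ?_, _, hne, fun j => .inr ⟨j, rfl⟩⟩ <;> simp [Config.setState, Config.broadcast]

theorem Step.of_finishRound {i : Fin n} (h : Step t byz c (.finishRound i) d) :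
    ∃ Q q, (c.state i).IsQuorum t Q q ∧ d.state i = (c.state i).endRound q := by
  obtain ⟨-, -, Q, q, hQ, rfl⟩ := h
  exact ⟨Q, q, hQ, by simp [Config.setState]⟩

theorem Step.phase_eq (h : Step t byz c a d) {i : Fin n} :
    (a = .bvBroadcast i → (c.state i).phase = .start) ∧
    (a = .auxBroadcast i → (c.state i).phase = .waitContestants) ∧
    (a = .finishRound i → (c.state i).phase = .waitFavorites) := by
  refine ⟨?_, ?_, ?_⟩ <;> rintro rfl <;> exact h.2.1

end Steps

/-- Of the three steps excluded in `control_eq`, `bvBroadcast` and `auxBroadcast` change the phase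
only. -/
theorem Step.est_eq {n t : ℕ} {byz : Finset (Fin n)} {c d : Config n} {a : Action n}
    (h : Step t byz c a d) (i : Fin n) (ha : a ≠ .finishRound i) :
    (d.state i).round = (c.state i).round ∧ (d.state i).est = (c.state i).est := by
  by_cases h₁ : a = .bvBroadcast i
  · subst h₁; obtain ⟨-, -, rfl⟩ := h; simp [Config.setState, Config.broadcast]
  by_cases h₂ : a = .auxBroadcast i
  · subst h₂; obtain ⟨-, -, -, rfl⟩ := h; simp [Config.setState, Config.broadcast]
  obtain ⟨hr, -, he⟩ := h.control_eq i h₁ h₂ ha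
  exact ⟨hr, he⟩

/-! ### Outcome of a round for one process -/

theorem roundParity_add_two (r : ℕ) : roundParity (r + 2) = roundParity r := by
  simp [roundParity]

namespace LocalState

variable {n t : ℕ} {s : LocalState n} {Q : Finset (Fin n)} {q : Set (Fin 2)} {v : Fin 2}

theorem endRound_est_of_singleton (hq : q = {v}) : (s.endRound q).est = v := by
  subst hq
  fin_cases v <;> simp [endRound]

/-- The fallback estimate is the parity of the round, so when `v` is this parity it makes no
difference whether the qualifiers are `{v}` or contain the other value as well. -/
theorem endRound_est_of_mem (hq : v ∈ q) (hv : v = roundParity s.round) :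
    (s.endRound q).est = v := by
  by_cases h : q = {v}
  · exact endRound_est_of_singleton h
  · have h' : ∀ w : Fin 2, q ≠ {w} := by
      rintro w rfl
      exact h (by rw [Set.mem_singleton_iff.1 hq])
    simp [endRound, h', hv]

/-- The value `w` is left open because an earlier decision takes precedence. -/
theorem endRound_decision (hq : q = {roundParity s.round}) :
    ∃ w, (s.endRound q).decision = some w := by
  cases hd : s.decision <;> simp [endRound, hq, hd]

theorem IsQuorum.nonempty (h : s.IsQuorum t Q q) (hn : t < n) : q.Nonempty := by
  obtain ⟨hc, hne, rfl, -⟩ := h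
  obtain ⟨j, hj⟩ : Q.Nonempty := Finset.card_pos.1 (by omega)
  obtain ⟨v, hv⟩ := hne j hj
  exact ⟨v, Set.mem_biUnion hj hv⟩

/-- Qualifiers are contestants by definition, and `n - t > 0` members with non-empty favorites make
them non-empty. -/
theorem IsQuorum.eq_singleton (h : s.IsQuorum t Q q) (hn : t < n)
    (hc : s.contestants s.round ⊆ {v}) : q = {v} :=
  (h.nonempty hn).subset_singleton_iff.1 (h.2.2.2.trans hc)

end LocalState

/-! ### Invariants of executions and safety of the bv-broadcast -/

namespace IsExecution

variable {n t r₀ : ℕ} {byz : Finset (Fin n)} {proposal : Fin n → Fin 2} {σ : ℕ → Config n}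
  {act : ℕ → Action n}

theorem sent_mono (h : IsExecution t byz r₀ proposal σ act) : Monotone fun k => (σ k).sent :=
  monotone_nat_of_le_succ fun k => (h.step k).sent_mono

theorem bvSent_mono (h : IsExecution t byz r₀ proposal σ act) (i : Fin n) (r : ℕ) :
    Monotone fun k => ((σ k).state i).bvSent r :=
  monotone_nat_of_le_succ fun k => ((h.step k).state_mono i).1 r

theorem contestants_mono (h : IsExecution t byz r₀ proposal σ act) (i : Fin n) (r : ℕ) :
    Monotone fun k => ((σ k).state i).contestants r :=
  monotone_nat_of_le_succ fun k => ((h.step k).state_mono i).2.1 r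

theorem received_mono (h : IsExecution t byz r₀ proposal σ act) (i : Fin n) :
    Monotone fun k => ((σ k).state i).received :=
  monotone_nat_of_le_succ fun k => ((h.step k).state_mono i).2.2

theorem bvCount_mono (h : IsExecution t byz r₀ proposal σ act) (i : Fin n) (r : ℕ) (v : Fin 2) :
    Monotone fun k => ((σ k).state i).bvCount r v :=
  fun _ _ hkl => Set.ncard_le_ncard (fun _ hj => h.received_mono i hkl hj) (Set.toFinite _)

theorem sent_of_received (h : IsExecution t byz r₀ proposal σ act) {i j : Fin n} (hi : i ∉ byz)
    {m : Message} {k : ℕ} (hm : (j, m) ∈ ((σ k).state i).received) : (j, i, m) ∈ (σ k).sent := by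
  induction k with
  | zero => simp [h.init_state i hi, LocalState.initial] at hm
  | succ k ih =>
    exact h.sent_mono k.le_succ (((h.step k).received_new hm).elim ih id)

theorem sent_bv_iff (h : IsExecution t byz r₀ proposal σ act) {i j : Fin n} (hj : j ∉ byz)
    {r : ℕ} {v : Fin 2} {k : ℕ} :
    (j, i, Message.bv r v) ∈ (σ k).sent ↔ v ∈ ((σ k).state j).bvSent r := by
  induction k with
  | zero => simp [h.init_state j hj, h.init_sent, LocalState.initial]
  | succ k ih => exact (h.step k).sent_bv_iff hj ih

/-- The set in an AUX message of a correct process is its non-empty set of contestants at some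
point in time. -/
theorem aux_eq_contestants (h : IsExecution t byz r₀ proposal σ act) {i j : Fin n} (hj : j ∉ byz)
    {r : ℕ} {S : Set (Fin 2)} {k : ℕ} (hm : (j, i, Message.aux r S) ∈ (σ k).sent) :
    S.Nonempty ∧ ∃ l, S = ((σ l).state j).contestants r := by
  induction k with
  | zero => simp [h.init_sent] at hm
  | succ k ih =>
    rcases (h.step k).sent_aux_new hj hm with hm | ⟨hS, hne⟩
    exacts [ih hm, ⟨hne, k, hS⟩]

/-- The guard held when `v` was delivered, and reception counts never decrease. -/
theorem two_mul_lt_bvCount (h : IsExecution t byz r₀ proposal σ act) {i : Fin n} (hi : i ∉ byz)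
    {r : ℕ} {v : Fin 2} {k : ℕ} (hv : v ∈ ((σ k).state i).contestants r) :
    2 * t + 1 ≤ ((σ k).state i).bvCount r v := by
  induction k with
  | zero => simp [h.init_state i hi, LocalState.initial] at hv
  | succ k ih =>
    exact (((h.step k).contestants_new hv).elim ih id).trans (h.bvCount_mono i r v k.le_succ)

/-- All but `byz.card` of the senders of received BV messages are correct. -/
theorem exists_correct_senders (h : IsExecution t byz r₀ proposal σ act) {i : Fin n}
    (hi : i ∉ byz) (r : ℕ) (v : Fin 2) (k : ℕ) :
    ∃ T : Finset (Fin n), ((σ k).state i).bvCount r v ≤ T.card + byz.card ∧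
      ∀ j ∈ T, j ∉ byz ∧ v ∈ ((σ k).state j).bvSent r := by
  classical
  set A : Set (Fin n) := {j | (j, Message.bv r v) ∈ ((σ k).state i).received} with hA
  refine ⟨A.toFinset \ byz, ?_, fun j hj => ?_⟩
  · rw [LocalState.bvCount, Set.ncard_eq_toFinset_card']
    exact Finset.card_le_card_sdiff_add_card
  · simp only [Finset.mem_sdiff, Set.mem_toFinset] at hj
    exact ⟨hj.2, (h.sent_bv_iff hj.2).1 (h.sent_of_received hi hj.1)⟩

/-- BV-Justification: if all correct processes start round `r` with the estimate `v`, then only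
`v` is broadcast by the correct processes in the bv-broadcast of round `r`, -/
theorem bvSent_subset (h : IsExecution t byz r₀ proposal σ act) (hbyz : byz.card ≤ t) {r : ℕ}
    {v : Fin 2} (hest : ∀ i ∉ byz, ∀ k, ((σ k).state i).phase = .start →
      ((σ k).state i).round = r → ((σ k).state i).est = v) (k : ℕ) :
    ∀ i ∉ byz, ((σ k).state i).bvSent r ⊆ {v} := by
  induction k with
  | zero => intro i hi; simp [h.init_state i hi, LocalState.initial]
  | succ k ih =>
    intro i hi w hw
    rcases (h.step k).bvSent_new hw with hw | ⟨hp, hr, rfl⟩ | hc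
    · exact ih i hi hw
    · exact hest i hi k hp hr
    -- Of `t + 1` senders at most `t` are Byzantine; a correct one had already broadcast `w`, so the
    -- induction hypothesis for that process applies.
    · obtain ⟨T, hT, hT'⟩ := h.exists_correct_senders hi r w k
      obtain ⟨j, hj⟩ : T.Nonempty := Finset.card_pos.1 (by omega)
      exact ih j (hT' j hj).1 (hT' j hj).2

/-- and only `v` is bv-delivered. -/
theorem contestants_subset (h : IsExecution t byz r₀ proposal σ act) (hbyz : byz.card ≤ t) {r : ℕ}
    {v : Fin 2} (hest : ∀ i ∉ byz, ∀ k, ((σ k).state i).phase = .start →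
      ((σ k).state i).round = r → ((σ k).state i).est = v) (k : ℕ) {i : Fin n} (hi : i ∉ byz) :
    ((σ k).state i).contestants r ⊆ {v} := by
  intro w hw
  have hc := h.two_mul_lt_bvCount hi hw
  obtain ⟨T, hT, hT'⟩ := h.exists_correct_senders hi r w k
  obtain ⟨j, hj⟩ : T.Nonempty := Finset.card_pos.1 (by omega)
  exact h.bvSent_subset hbyz hest k j (hT' j hj).1 (hT' j hj).2

/-! ### Liveness -/

/-- A condition that enables a step of the algorithm and is stable until this step is taken leads
to this step. -/
theorem exists_act (h : IsExecution t byz r₀ proposal σ act) {a : Action n}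
    (ha : a.IsAlgorithmStep) {P : ℕ → Prop} {k : ℕ} (hk : P k)
    (hP : ∀ l, P l → act l ≠ a → P (l + 1))
    (hE : ∀ᶠ l in atTop, P l → Enabled t byz (σ l) a) : ∃ l, P l ∧ act l = a := by
  by_contra! hne
  have hall : ∀ l, k ≤ l → P l := fun l hl => by
    induction l, hl using Nat.le_induction with
    | base => exact hk
    | succ l _ ih => exact hP l ih (hne l ih)
  obtain ⟨K, hK⟩ := eventually_atTop.1 hE
  obtain ⟨l, hl, hl'⟩ := h.progress a ha (max k K)
  have hPl := hall l (le_of_max_le_left hl)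
  exact hl'.elim (hne l hPl) fun hn => hn (hK l (le_of_max_le_right hl) hPl)

theorem eventually_received (h : IsExecution t byz r₀ proposal σ act) {i j : Fin n}
    (hi : i ∉ byz) (hj : j ∉ byz) {m : Message} {k : ℕ} (hm : (j, i, m) ∈ (σ k).sent) :
    ∀ᶠ l in atTop, (j, m) ∈ ((σ l).state i).received := by
  obtain ⟨l, hl⟩ := h.reliable i j m k hi hj hm
  exact eventually_atTop.2 ⟨l, fun l' hl' => h.received_mono i hl' hl⟩

/-- The members of `T` may broadcast at different times; as `T` is finite, one moment bounds all the
receptions. -/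
theorem eventually_card_le_bvCount (h : IsExecution t byz r₀ proposal σ act) {i : Fin n}
    (hi : i ∉ byz) {r : ℕ} {v : Fin 2} {T : Finset (Fin n)}
    (hT : ∀ j ∈ T, j ∉ byz ∧ ∃ k, v ∈ ((σ k).state j).bvSent r) :
    ∀ᶠ l in atTop, T.card ≤ ((σ l).state i).bvCount r v := by
  have : ∀ᶠ l in atTop, ∀ j ∈ T, (j, Message.bv r v) ∈ ((σ l).state i).received := by
    refine (eventually_all_finset T).2 fun j hj => ?_
    obtain ⟨hj', k, hk⟩ := hT j hj
    exact h.eventually_received hi hj' ((h.sent_bv_iff hj').2 hk)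
  filter_upwards [this] with l hl
  rw [← Set.ncard_coe_finset]
  exact Set.ncard_le_ncard hl (Set.toFinite _)

/-- If `v` were never broadcast by `i`, the re-broadcast would eventually stay enabled for ever, so
it would be taken. Only the invocation of the instance at `i` is needed: it stays active after `i`
has left round `r`. -/
theorem exists_mem_bvSent (h : IsExecution t byz r₀ proposal σ act) {i : Fin n}
    (hi : i ∉ byz) {r : ℕ} {v : Fin 2} (hinv : ∃ k, (((σ k).state i).bvSent r).Nonempty)
    {T : Finset (Fin n)} (hT : ∀ j ∈ T, j ∉ byz ∧ ∃ k, v ∈ ((σ k).state j).bvSent r)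
    (hcard : t + 1 ≤ T.card) : ∃ k, v ∈ ((σ k).state i).bvSent r := by
  by_contra! hne
  obtain ⟨K, hK⟩ := hinv
  have hE : ∀ᶠ l in atTop, Enabled t byz (σ l) (.bvRebroadcast i r v) := by
    filter_upwards [h.eventually_card_le_bvCount hi hT, eventually_ge_atTop K] with l hl hKl
    exact ⟨_, hi, hK.mono (h.bvSent_mono i r hKl), hne l, hcard.trans hl, rfl⟩
  obtain ⟨l, -, hl⟩ := h.exists_act (P := fun _ => True) (a := .bvRebroadcast i r v) trivial
    (k := 0) trivial (fun _ _ _ => trivial) (hE.mono fun _ hl _ => hl)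
  have hs := h.step l
  rw [hl] at hs
  obtain ⟨-, -, -, -, hs⟩ := hs
  exact hne (l + 1) (by simp [hs, Config.setState])

theorem exists_mem_contestants (h : IsExecution t byz r₀ proposal σ act) {i : Fin n}
    (hi : i ∉ byz) {r : ℕ} {v : Fin 2} (hinv : ∃ k, (((σ k).state i).bvSent r).Nonempty)
    {T : Finset (Fin n)} (hT : ∀ j ∈ T, j ∉ byz ∧ ∃ k, v ∈ ((σ k).state j).bvSent r)
    (hcard : 2 * t + 1 ≤ T.card) : ∃ k, v ∈ ((σ k).state i).contestants r := by
  by_contra! hne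
  obtain ⟨K, hK⟩ := hinv
  have hE : ∀ᶠ l in atTop, Enabled t byz (σ l) (.bvDeliver i r v) := by
    filter_upwards [h.eventually_card_le_bvCount hi hT, eventually_ge_atTop K] with l hl hKl
    exact ⟨_, hi, hK.mono (h.bvSent_mono i r hKl), hne l, hcard.trans hl, rfl⟩
  obtain ⟨l, -, hl⟩ := h.exists_act (P := fun _ => True) (a := .bvDeliver i r v) trivial
    (k := 0) trivial (fun _ _ _ => trivial) (hE.mono fun _ hl _ => hl)
  have hs := h.step l
  rw [hl] at hs
  obtain ⟨-, -, -, -, hs⟩ := hs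
  exact hne (l + 1) (by simp [hs, Config.setState])

/-- BV-Obligation: a value broadcast by `t + 1` correct processes is bv-delivered by all correct
processes. -/
theorem bv_obligation (h : IsExecution t byz r₀ proposal σ act) (hn : 2 * t + byz.card < n) {r : ℕ}
    (hinv : ∀ i ∉ byz, ∃ k, (((σ k).state i).bvSent r).Nonempty) {v : Fin 2}
    {T : Finset (Fin n)} (hT : ∀ j ∈ T, j ∉ byz ∧ ∃ k, v ∈ ((σ k).state j).bvSent r)
    (hcard : t + 1 ≤ T.card) {i : Fin n} (hi : i ∉ byz) :
    ∃ k, v ∈ ((σ k).state i).contestants r := by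
  -- Every correct process re-broadcasts `v`, and there are `n - byz.card ≥ 2t + 1` of them.
  refine h.exists_mem_contestants hi (hinv i hi) (T := byzᶜ) (fun j hj => ?_) ?_
  · rw [Finset.mem_compl] at hj
    exact ⟨hj, h.exists_mem_bvSent hj (hinv j hj) hT hcard⟩
  · rw [Finset.card_compl, Fintype.card_fin]; omega

/-- BV-Uniformity: a value bv-delivered by a correct process is bv-delivered by all of them. -/
theorem bv_uniformity (h : IsExecution t byz r₀ proposal σ act) (hbyz : byz.card ≤ t)
    (hn : 3 * t < n) {r : ℕ}
    (hinv : ∀ i ∉ byz, ∃ k, (((σ k).state i).bvSent r).Nonempty) {v : Fin 2} {i j : Fin n}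
    (hi : i ∉ byz) (hj : j ∉ byz) {k : ℕ} (hv : v ∈ ((σ k).state j).contestants r) :
    ∃ l, v ∈ ((σ l).state i).contestants r := by
  have hc := h.two_mul_lt_bvCount hj hv
  obtain ⟨T, hT, hT'⟩ := h.exists_correct_senders hj r v k
  -- At least `2t + 1 - byz.card ≥ t + 1` of the senders behind the delivery are correct.
  exact h.bv_obligation (by omega) hinv (fun j hj => ⟨(hT' j hj).1, k, (hT' j hj).2⟩)
    (by omega) hi

/-- BV-Termination: if all correct processes invoke bv-broadcast, all of them bv-deliver. -/
theorem bv_termination (h : IsExecution t byz r₀ proposal σ act) (hn : 2 * t + byz.card < n)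
    {r : ℕ} (hinv : ∀ i ∉ byz, ∃ k, (((σ k).state i).bvSent r).Nonempty) {i : Fin n}
    (hi : i ∉ byz) : ∃ k, (((σ k).state i).contestants r).Nonempty := by
  have hval : ∀ j, ∃ v, j ∉ byz → ∃ k, v ∈ ((σ k).state j).bvSent r := fun j => by
    by_cases hj : j ∈ byz
    -- An arbitrary value, which makes `val` total.
    · exact ⟨0, fun hj' => absurd hj hj'⟩
    · obtain ⟨k, v, hv⟩ := hinv j hj
      exact ⟨v, fun _ => ⟨k, hv⟩⟩
  choose val hval using hval
  have hcard : byzᶜ.card = n - byz.card := by rw [Finset.card_compl, Fintype.card_fin]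
  -- Pigeonhole: more than `2t` correct processes and two values.
  obtain ⟨v, -, hv⟩ := Finset.exists_lt_card_fiber_of_mul_lt_card_of_maps_to
    (s := byzᶜ) (t := (Finset.univ : Finset (Fin 2))) (f := val) (n := t)
    (fun _ _ => Finset.mem_univ _) (by rw [hcard, Finset.card_univ, Fintype.card_fin]; omega)
  obtain ⟨k, hk⟩ := h.bv_obligation hn hinv (v := v) (fun j hj => by
    rw [Finset.mem_filter, Finset.mem_compl] at hj
    exact ⟨hj.1, hj.2 ▸ hval j hj.1⟩) hv hi
  exact ⟨k, v, hk⟩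

theorem exists_waitContestants (h : IsExecution t byz r₀ proposal σ act) {i : Fin n}
    (hi : i ∉ byz) {r k : ℕ} (hk : ((σ k).state i).round = r ∧ ((σ k).state i).phase = .start) :
    ∃ l, (((σ l).state i).round = r ∧ ((σ l).state i).phase = .waitContestants) ∧
      (((σ l).state i).bvSent r).Nonempty := by
  obtain ⟨l, ⟨hr, -⟩, hl⟩ := h.exists_act (a := .bvBroadcast i)
    (P := fun l => ((σ l).state i).round = r ∧ ((σ l).state i).phase = .start) trivial hk
    (fun l hPl hl => by
      obtain ⟨hr, hp, -⟩ := (h.step l).control_eq i hl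
        (fun e => by have := (h.step l).phase_eq.2.1 e; simp [hPl.2] at this)
        (fun e => by have := (h.step l).phase_eq.2.2 e; simp [hPl.2] at this)
      exact ⟨hr.trans hPl.1, hp.trans hPl.2⟩)
    (.of_forall fun l hPl => ⟨_, hi, hPl.2, rfl⟩)
  have hs := h.step l
  rw [hl] at hs
  obtain ⟨h₁, h₂, h₃⟩ := hs.of_bvBroadcast
  exact ⟨l + 1, ⟨h₁.trans hr, h₂⟩, hr ▸ h₃⟩

/-- The delivery in `hc` may occur at any time: contestants only grow, so the guard eventually holds
for good while `i` waits. -/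
theorem exists_waitFavorites (h : IsExecution t byz r₀ proposal σ act) {i : Fin n}
    (hi : i ∉ byz) {r k : ℕ}
    (hk : ((σ k).state i).round = r ∧ ((σ k).state i).phase = .waitContestants)
    (hc : ∃ l, (((σ l).state i).contestants r).Nonempty) :
    ∃ l, (((σ l).state i).round = r ∧ ((σ l).state i).phase = .waitFavorites) ∧
      ∃ S : Set (Fin 2), S.Nonempty ∧ ∀ j, (i, j, Message.aux r S) ∈ (σ l).sent := by
  obtain ⟨K, hK⟩ := hc
  obtain ⟨l, ⟨hr, -⟩, hl⟩ := h.exists_act (a := .auxBroadcast i)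
    (P := fun l => ((σ l).state i).round = r ∧ ((σ l).state i).phase = .waitContestants) trivial hk
    (fun l hPl hl => by
      obtain ⟨hr, hp, -⟩ := (h.step l).control_eq i
        (fun e => by have := (h.step l).phase_eq.1 e; simp [hPl.2] at this) hl
        (fun e => by have := (h.step l).phase_eq.2.2 e; simp [hPl.2] at this)
      exact ⟨hr.trans hPl.1, hp.trans hPl.2⟩)
    ((eventually_ge_atTop K).mono fun l hKl hPl =>
      ⟨_, hi, hPl.2, by rw [hPl.1]; exact hK.mono (h.contestants_mono i r hKl), rfl⟩)
  have hs := h.step l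
  rw [hl] at hs
  obtain ⟨h₁, h₂, h₃⟩ := hs.of_auxBroadcast
  exact ⟨l + 1, ⟨h₁.trans hr, h₂⟩, hr ▸ h₃⟩

/-- Each wait ends because its guard eventually holds permanently: delivery by `bv_termination`,
then receipt of all correct AUX messages, whose values reach the contestants of `i` by
`bv_uniformity`. -/
theorem exists_finishRound (h : IsExecution t byz r₀ proposal σ act) (hbyz : byz.card ≤ t)
    (hn : 3 * t < n) {r : ℕ} (hstart : ∀ i ∉ byz, ∃ k, ((σ k).state i).round = r ∧
      ((σ k).state i).phase = .start) {i : Fin n} (hi : i ∉ byz) :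
    ∃ l, ((σ l).state i).round = r ∧ act l = .finishRound i := by
  have hwc := fun j hj => h.exists_waitContestants (i := j) hj (hstart j hj).choose_spec
  have hinv : ∀ j ∉ byz, ∃ k, (((σ k).state j).bvSent r).Nonempty := fun j hj =>
    (hwc j hj).imp fun _ hk => hk.2
  have hwf := fun j hj => h.exists_waitFavorites (i := j) hj (hwc j hj).choose_spec.1
    (h.bv_termination (by omega) hinv hj)
  have hfav : ∀ᶠ l in atTop, ∀ j ∈ byzᶜ, (((σ l).state i).favorites r j).Nonempty := by
    refine (eventually_all_finset _).2 fun j hj => ?_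
    rw [Finset.mem_compl] at hj
    obtain ⟨k, -, S, ⟨v, hv⟩, hS⟩ := hwf j hj
    exact (h.eventually_received hi hj (hS i)).mono fun l hl => ⟨v, S, hl, hv⟩
  -- There are only two values, so one moment works for everything that any correct process ever
  -- delivers, even later than that moment.
  have hcon : ∀ᶠ l in atTop, ∀ v : Fin 2, (∃ j ∉ byz, ∃ k, v ∈ ((σ k).state j).contestants r) →
      v ∈ ((σ l).state i).contestants r := by
    refine eventually_all.2 fun v => ?_
    by_cases hv : ∃ j ∉ byz, ∃ k, v ∈ ((σ k).state j).contestants r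
    · obtain ⟨j, hj, k, hk⟩ := hv
      obtain ⟨l, hl⟩ := h.bv_uniformity hbyz hn hinv hi hj hk
      exact (eventually_ge_atTop l).mono fun l' hl' _ => h.contestants_mono i r hl' hl
    · exact .of_forall fun l hv' => absurd hv' hv
  -- Any `n - t` correct processes serve as quorum; there are enough since `byz.card ≤ t`.
  obtain ⟨Q, hQ, hQc⟩ := Finset.exists_subset_card_eq (s := byzᶜ) (n := n - t)
    (by rw [Finset.card_compl, Fintype.card_fin]; omega)
  obtain ⟨k, hk, -⟩ := hwf i hi
  obtain ⟨l, hl, hl'⟩ := h.exists_act (a := .finishRound i)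
    (P := fun l => ((σ l).state i).round = r ∧ ((σ l).state i).phase = .waitFavorites) trivial hk
    (fun l hPl hl => by
      obtain ⟨hr, hp, -⟩ := (h.step l).control_eq i
        (fun e => by have := (h.step l).phase_eq.1 e; simp [hPl.2] at this)
        (fun e => by have := (h.step l).phase_eq.2.1 e; simp [hPl.2] at this) hl
      exact ⟨hr.trans hPl.1, hp.trans hPl.2⟩)
    (by
      filter_upwards [hfav, hcon] with l hf hc hPl
      refine ⟨_, hi, hPl.2, Q, _, ⟨hQc, fun j hj => hPl.1 ▸ hf j (hQ hj), rfl, ?_⟩, rfl⟩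
      -- Qualifiers are contestants: each comes from an AUX set of a correct `j`, hence was
      -- delivered by `j`, and `hcon` applies.
      rw [hPl.1]
      refine Set.iUnion₂_subset fun j hj v hv => ?_
      obtain ⟨S, hS, hv⟩ := hv
      have hj' := Finset.mem_compl.1 (hQ hj)
      obtain ⟨-, k, rfl⟩ := h.aux_eq_contestants hj' (h.sent_of_received hi hS)
      exact hc v ⟨j, hj', k, hv⟩)
  exact ⟨l, hl.1, hl'⟩

/-- Every correct process reaches every round. -/
theorem exists_start (h : IsExecution t byz r₀ proposal σ act) (hbyz : byz.card ≤ t)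
    (hn : 3 * t < n) {r : ℕ} (hr : r₀ ≤ r) : ∀ i ∉ byz, ∃ k, ((σ k).state i).round = r ∧
      ((σ k).state i).phase = .start := by
  induction r, hr using Nat.le_induction with
  | base => exact fun i hi => ⟨0, by simp [h.init_state i hi, LocalState.initial]⟩
  | succ r _ ih =>
    intro i hi
    obtain ⟨l, hr, hl⟩ := h.exists_finishRound hbyz hn ih hi
    have hs := h.step l
    rw [hl] at hs
    obtain ⟨Q, q, -, hs⟩ := hs.of_finishRound
    exact ⟨l + 1, by simp [hs, LocalState.endRound, hr]⟩

/-! ### Agreement after a good round -/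

/-- An estimate that results from every possible end of round `r` is the estimate in the next
round. -/
theorem est_eq_of_round_eq_succ (h : IsExecution t byz r₀ proposal σ act) {r : ℕ} (hr : r₀ ≤ r)
    {v : Fin 2} {i : Fin n} (hi : i ∉ byz)
    (hv : ∀ k Q q, ((σ k).state i).round = r → ((σ k).state i).IsQuorum t Q q →
      (((σ k).state i).endRound q).est = v) (k : ℕ) (hk : ((σ k).state i).round = r + 1) :
    ((σ k).state i).est = v := by
  induction k with
  -- The initial round `r₀ ≤ r` is not `r + 1`, so the estimate in round `r + 1` is never an initial
  -- proposal.
  | zero => simp [h.init_state i hi, LocalState.initial] at hk; omega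
  | succ k ih =>
    have hs := h.step k
    by_cases ha : act k = .finishRound i
    · rw [ha] at hs
      obtain ⟨Q, q, hQ, hs⟩ := hs.of_finishRound
      rw [hs] at hk ⊢
      exact hv k Q q (by simpa [LocalState.endRound] using hk) hQ
    · obtain ⟨h₁, h₂⟩ := hs.est_eq i ha
      rw [h₂]
      exact ih (h₁ ▸ hk)

/-- One correct quorum member suffices: its AUX set contains the parity of `r`, which thereby
becomes a qualifier. -/
theorem endRound_est_of_good (h : IsExecution t byz r₀ proposal σ act) (hbyz : byz.card ≤ t)
    (hn : 3 * t < n) {r : ℕ} (hgood : GoodBV byz σ r (roundParity r)) {i : Fin n} (hi : i ∉ byz)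
    {k : ℕ} {Q : Finset (Fin n)} {q : Set (Fin 2)} (hr : ((σ k).state i).round = r)
    (hQ : ((σ k).state i).IsQuorum t Q q) :
    (((σ k).state i).endRound q).est = roundParity r := by
  obtain ⟨j, hj, hjb⟩ := Finset.exists_mem_notMem_of_card_lt_card (s := byz) (t := Q)
    (by rw [hQ.1]; omega)
  refine LocalState.endRound_est_of_mem ?_ (by rw [hr])
  rw [hQ.2.2.1]
  refine Set.mem_biUnion hj ?_
  obtain ⟨w, S, hS, -⟩ := hQ.2.1 j hj
  rw [hr] at hS ⊢
  refine ⟨S, hS, ?_⟩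
  obtain ⟨hne, l, hl⟩ := h.aux_eq_contestants hjb (h.sent_of_received hi hS)
  -- A non-empty set of binary values missing the parity would be `{1 - roundParity r}`, a snapshot
  -- that goodness rules out.
  by_contra hv
  refine hgood j hjb l ?_
  rw [← hl]
  refine hne.subset_singleton_iff.1 fun w hw => ?_
  have hwv : w ≠ roundParity r := fun e => hv (e ▸ hw)
  rw [Set.mem_singleton_iff]
  generalize roundParity r = v at hwv
  clear hw
  decide +revert

end IsExecution

end DBFT

/-! ### Decision two rounds after the good round -/

theorem mainTheorem1 (n t f : ℕ) (hft : f ≤ t) (htn : 3 * t < n)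
    (byz : Finset (Fin n)) (hbyz : byz.card = f)
    (r₀ : ℕ) (proposal : Fin n → Fin 2)
    (σ : ℕ → DBFT.Config n) (act : ℕ → DBFT.Action n)
    (hexec : DBFT.IsExecution t byz r₀ proposal σ act)
    (hfair : DBFT.FairBV byz r₀ σ) :
    DBFT.Terminates byz σ := by
  obtain ⟨r, hr, hgood⟩ := hfair
  have hb : byz.card ≤ t := hbyz.trans_le hft
  have htn' : t < n := by omega
  have est₁ : ∀ i ∉ byz, ∀ k, ((σ k).state i).round = r + 1 →
      ((σ k).state i).est = DBFT.roundParity r := fun i hi =>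
    hexec.est_eq_of_round_eq_succ hr hi fun k Q q hk hQ =>
      hexec.endRound_est_of_good hb htn hgood hi hk hQ
  -- Round `r + 1` has the other parity, so qualifiers `{v}` yield no decision there but keep the
  -- estimate.
  have est₂ : ∀ i ∉ byz, ∀ k, ((σ k).state i).round = r + 2 →
      ((σ k).state i).est = DBFT.roundParity r := fun i hi =>
    hexec.est_eq_of_round_eq_succ (by omega) hi fun k Q q hk hQ =>
      DBFT.LocalState.endRound_est_of_singleton <| hQ.eq_singleton htn' <| hk ▸
        hexec.contestants_subset hb (fun i hi k _ => est₁ i hi k) k hi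
  intro i hi
  obtain ⟨l, hl, hact⟩ := hexec.exists_finishRound hb htn
    (hexec.exists_start hb htn (show r₀ ≤ r + 2 by omega)) hi
  have hs := hexec.step l
  rw [hact] at hs
  obtain ⟨Q, q, hQ, hs⟩ := hs.of_finishRound
  refine ⟨l + 1, ?_⟩
  rw [hs]
  refine DBFT.LocalState.endRound_decision ?_
  -- The common value is again the parity of the round, so the singleton of qualifiers triggers the
  -- decision.
  rw [hl, DBFT.roundParity_add_two]
  exact hQ.eq_singleton htn' <| hl ▸
    hexec.contestants_subset hb (fun i hi k _ => est₂ i hi k) l hi
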